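/- Let $\theta_0\in(0,1)$ and let $\Pi$ be a probability measure (the prior) on $[0,1]$ which, on some neighbourhood of $\theta_0$, has a continuous, strictly positive density with respect to Lebesgue measure (nothing is assumed about $\Pi$ outside that neighbourhood). Let $X_1,X_2,\dots$ be i.i.d. $\mathrm{Bern}(\theta_0)$ random variables on a probability space with probability measure $\mathbb P_{\theta_0}$, put $\mathcal F_n=\sigma(X_1,\dots,X_n)$ and $S_n=X_1+\dots+X_n$, and let \[ \Pi(A\mid\mathcal F_n)=\frac{\int_A\theta^{S_n}(1-\theta)^{n-S_n}\,d\Pi(\theta)}{\int_{[0,1]}\theta^{S_n}(1-\theta)^{n-S_n}\,d\Pi(\theta)},\qquad A\subseteq[0,1]\text{ measurable}, \] be the posterior under the prior $\Pi$. Write $\mathbb E[g(\theta)\mid\mathcal F_n]=\int_{[0,1]} g(\theta)\,\Pi(d\theta\mid\mathcal F_n)$ and let $m_n=\mathbb E[\theta\mid\mathcal F_n]$ be the posterior mean. Then for every fixed integer $k\ge 2$, as $n\to\infty$, \[ \mathbb E[(1-\theta)^k\mid\mathcal F_n]-(1-m_n)^k=O(n^{-1})\qquad\mathbb P_{\theta_0}\text{-almost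 surely}, \] that is, almost surely the difference between the Bayes $k$-step predictive $\mathbb E[(1-\theta)^k\mid\mathcal F_n]$ and the plug-in predictive $(1-m_n)^k$ is bounded in absolute value by $C/n$ for all sufficiently large $n$, where the constant $C$ may depend on the realised data sequence. -/

import Mathlib

open MeasureTheory ProbabilityTheory Filter Topology Asymptotics
open scoped ENNReal unitInterval

noncomputable section

/-- `S_n`, the number of successes among the first `n` observations of the binary sequence `x`
(indexed from `0`). -/
def successCount (x : ℕ → Bool) (n : ℕ) : ℕ :=
  ((Finset.range n).filter fun i => x i = true).card

/-- The Bernoulli likelihood `θ ^ S_n * (1 - θ) ^ (n - S_n)` of the first `n` observations. -/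
def bernoulliLikelihood (x : ℕ → Bool) (n : ℕ) (θ : I) : ℝ :=
  (θ : ℝ) ^ successCount x n * (1 - (θ : ℝ)) ^ (n - successCount x n)

/-- The posterior given the first `n` observations of `x` under the prior `π` on `[0, 1]`:
`A ↦ (∫_A likelihood dπ) / (∫_{[0,1]} likelihood dπ)`. -/
def bernoulliPosterior (π : Measure I) (x : ℕ → Bool) (n : ℕ) : Measure I :=
  (∫⁻ θ, ENNReal.ofReal (bernoulliLikelihood x n θ) ∂π)⁻¹ •
    π.withDensity fun θ => ENNReal.ofReal (bernoulliLikelihood x n θ)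

/-- The posterior mean `m_n`. -/
def posteriorMean (π : Measure I) (x : ℕ → Bool) (n : ℕ) : ℝ :=
  ∫ θ, (θ : ℝ) ∂(bernoulliPosterior π x n)

/-- The Bayes `k`-step predictive: the posterior expectation of `(1 - θ) ^ k`, i.e. the posterior
predictive probability that the next `k` observations all vanish. -/
def bayesPredictive (π : Measure I) (k : ℕ) (x : ℕ → Bool) (n : ℕ) : ℝ :=
  ∫ θ, (1 - (θ : ℝ)) ^ k ∂(bernoulliPosterior π x n)

/-- The plug-in `k`-step predictive `(1 - m_n) ^ k`. -/
def plugInPredictive (π : Measure I) (k : ℕ) (x : ℕ → Bool) (n : ℕ) : ℝ :=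
  (1 - posteriorMean π x n) ^ k

/-- On some open neighbourhood of `θ₀` in `[0, 1]`, the measure `π` has a density with respect to
Lebesgue measure that is continuous and strictly positive there. Nothing is required of `π`
outside that neighbourhood. -/
def HasContinuousPositiveDensityNear (π : Measure I) (θ₀ : I) : Prop :=
  ∃ U : Set I, IsOpen U ∧ θ₀ ∈ U ∧ ∃ f : I → ℝ, ContinuousOn f U ∧ (∀ θ ∈ U, 0 < f θ) ∧
    ∀ A : Set I, MeasurableSet A → A ⊆ U → π A = ∫⁻ θ in A, ENNReal.ofReal (f θ)

end

/-! The argument is pathwise: all it needs from the data is that p = S_n/n tends to θ₀, which the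
strong law supplies. Expanding (1 - θ)^k about the posterior mean, the linear term integrates to
zero, so the gap is at most k² times the posterior variance, hence at most k² times the posterior
second moment about p (`abs_integral_pow_sub_pow_integral_le`). That moment is O(1/n) by a
Laplace-type comparison. With M the likelihood at p, the likelihood is at most M exp(-n(θ - p)²/2)
on all of [0,1], and at least a constant times M when |θ - p| is of order n^(-1/2). Near θ₀ the
prior is comparable to Lebesgue measure, so the numerator is at most a constant times M n^(-3/2) and
the normaliser at least a constant times M n^(-1/2). Prior mass far from θ₀ is arbitrary but
exponentially suppressed. -/

/-! ### Jensen gap and variance -/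

lemma pow_sub_tangent_nonneg_and_le {y z : ℝ} (hy : y ∈ Set.Icc (0 : ℝ) 1)
    (hz : z ∈ Set.Icc (0 : ℝ) 1) (k : ℕ) :
    0 ≤ y ^ k - z ^ k - k * z ^ (k - 1) * (y - z) ∧
      y ^ k - z ^ k - k * z ^ (k - 1) * (y - z) ≤ k ^ 2 * (y - z) ^ 2 := by
  obtain ⟨hy0, hy1⟩ := hy
  obtain ⟨hz0, hz1⟩ := hz
  induction k with
  | zero => simp
  | succ k ih =>
    obtain ⟨h0, h1⟩ := ih
    -- Recursion for the tangent remainder; the bound closes because k² + k ≤ (k + 1)².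
    have key : y ^ (k + 1) - z ^ (k + 1) - (k + 1 : ℕ) * z ^ (k + 1 - 1) * (y - z) =
        y * (y ^ k - z ^ k - k * z ^ (k - 1) * (y - z)) + k * z ^ (k - 1) * (y - z) ^ 2 := by
      rcases k with _ | k
      · simp
      · simp only [Nat.add_sub_cancel]
        push_cast
        ring
    rw [key]
    have hzk0 : 0 ≤ z ^ (k - 1) := by positivity
    have hzk1 : z ^ (k - 1) ≤ 1 := pow_le_one₀ hz0 hz1
    have hk : (0 : ℝ) ≤ k := by positivity
    have hsq := sq_nonneg (y - z)
    refine ⟨by positivity, ?_⟩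
    have h2 : y * (y ^ k - z ^ k - k * z ^ (k - 1) * (y - z)) ≤ k ^ 2 * (y - z) ^ 2 :=
      (mul_le_of_le_one_left h0 hy1).trans h1
    have h3 : k * z ^ (k - 1) * (y - z) ^ 2 ≤ k * (y - z) ^ 2 :=
      mul_le_mul_of_nonneg_right (mul_le_of_le_one_right hk hzk1) hsq
    push_cast
    nlinarith [mul_nonneg hk hsq]

lemma integrable_of_continuous_unitInterval {μ : Measure I} [IsFiniteMeasure μ] {g : I → ℝ}
    (hg : Continuous g) : Integrable g μ :=
  hg.integrable_of_hasCompactSupport (HasCompactSupport.of_compactSpace g)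

/-- The centre `c` is free because the mean minimises the second moment; it will be the empirical
frequency. -/
lemma abs_integral_pow_sub_pow_integral_le (Q : Measure I) [IsProbabilityMeasure Q] (k : ℕ)
    (c : ℝ) :
    |∫ θ, (1 - (θ : ℝ)) ^ k ∂Q - (1 - ∫ θ, (θ : ℝ) ∂Q) ^ k| ≤
      k ^ 2 * ∫ θ, ((θ : ℝ) - c) ^ 2 ∂Q := by
  set m := ∫ θ, (θ : ℝ) ∂Q with hm
  have hid : Integrable (fun θ : I => (θ : ℝ)) Q := integrable_of_continuous_unitInterval (by fun_prop)
  have hm0 : 0 ≤ m := integral_nonneg fun θ => θ.2.1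
  have hm1 : m ≤ 1 := by
    have := integral_mono hid (integrable_const (1 : ℝ)) fun θ => θ.2.2
    simpa using this
  have hlin : ∫ θ, (((1 - (θ : ℝ)) ^ k - (1 - m) ^ k) -
      k * (1 - m) ^ (k - 1) * ((1 - (θ : ℝ)) - (1 - m))) ∂Q =
      ∫ θ, (1 - (θ : ℝ)) ^ k ∂Q - (1 - m) ^ k := by
    rw [integral_sub (integrable_of_continuous_unitInterval (by fun_prop))
      (integrable_of_continuous_unitInterval (by fun_prop)), integral_const_mul,
      integral_sub (integrable_of_continuous_unitInterval (by fun_prop)) (integrable_const _),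
      integral_sub (integrable_of_continuous_unitInterval (by fun_prop)) (integrable_const _),
      integral_sub (integrable_const _) hid, ← hm]
    simp
  have hbd : ∀ θ : I, _ := fun θ => pow_sub_tangent_nonneg_and_le
    (y := 1 - (θ : ℝ)) (z := 1 - m) ⟨by linarith [θ.2.2], by linarith [θ.2.1]⟩
    ⟨by linarith, by linarith⟩ k
  have hvar : ∫ θ, ((1 - (θ : ℝ)) - (1 - m)) ^ 2 ∂Q ≤ ∫ θ, ((θ : ℝ) - c) ^ 2 ∂Q := by
    have hrw : ∀ θ : I, ((θ : ℝ) - c) ^ 2 =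
        ((1 - (θ : ℝ)) - (1 - m)) ^ 2 + (2 * (m - c) * (θ - m) + (m - c) ^ 2) := fun θ => by ring
    simp_rw [hrw]
    rw [integral_add (integrable_of_continuous_unitInterval (by fun_prop))
      (integrable_of_continuous_unitInterval (by fun_prop)),
      integral_add (integrable_of_continuous_unitInterval (by fun_prop)) (integrable_const _),
      integral_const_mul, integral_sub hid (integrable_const _), ← hm]
    simp [sq_nonneg]
  rw [← hlin, abs_of_nonneg (integral_nonneg fun θ => (hbd θ).1)]
  calc _ ≤ ∫ θ, (k : ℝ) ^ 2 * ((1 - (θ : ℝ)) - (1 - m)) ^ 2 ∂Q :=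
        integral_mono (integrable_of_continuous_unitInterval (by fun_prop))
          (integrable_of_continuous_unitInterval (by fun_prop)) fun θ => (hbd θ).2
    _ ≤ _ := by
        rw [integral_const_mul]
        gcongr

/-! ### Two-sided Gaussian bounds on the likelihood -/

/-- Comparison with a Gaussian, from the Hellinger lower bound on relative entropy. -/
lemma pow_mul_pow_le_mul_exp {s t : ℕ} (hs : 0 < s) (ht : 0 < t) {θ : ℝ}
    (hθ : θ ∈ Set.Icc (0 : ℝ) 1) :
    θ ^ s * (1 - θ) ^ t ≤
      ((s / (s + t) : ℝ) ^ s * (1 - s / (s + t) : ℝ) ^ t) *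
        Real.exp (-((s + t) * (θ - s / (s + t)) ^ 2 / 2)) := by
  have hsR : (0 : ℝ) < s := by exact_mod_cast hs
  have htR : (0 : ℝ) < t := by exact_mod_cast ht
  have hn : (0 : ℝ) < s + t := by positivity
  set p : ℝ := s / (s + t) with hp
  have hp0 : 0 < p := by positivity
  have hq : 1 - p = t / (s + t) := by rw [hp]; field_simp; ring
  have hq0 : 0 < 1 - p := by rw [hq]; positivity
  have hsp : (s : ℝ) = (s + t) * p := by rw [hp]; field_simp
  have htp : (t : ℝ) = (s + t) * (1 - p) := by rw [hq]; field_simp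
  have key : ∀ (u v : ℝ) (j : ℕ), 0 < u → 0 ≤ v →
      v ^ j ≤ u ^ j * Real.exp (2 * j * (√v / √u - 1)) := by
    intro u v j hu hv
    have h1 : √v / √u ≤ Real.exp (√v / √u - 1) := by
      linarith [Real.add_one_le_exp (√v / √u - 1)]
    have h2 : (v / u) ^ j ≤ Real.exp (2 * j * (√v / √u - 1)) := by
      have h3 : v / u = (√v / √u) ^ 2 := by
        rw [div_pow, Real.sq_sqrt hv, Real.sq_sqrt hu.le]
      rw [h3, ← pow_mul, show 2 * (j : ℝ) * (√v / √u - 1) = ((2 * j : ℕ) : ℝ) * (√v / √u - 1) by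
        push_cast; ring, Real.exp_nat_mul]
      exact pow_le_pow_left₀ (by positivity) h1 _
    rw [div_pow, div_le_iff₀ (by positivity)] at h2
    linarith
  have hA := key p θ s hp0 hθ.1
  have hB := key (1 - p) (1 - θ) t hq0 (by linarith [hθ.2])
  have hθ' : 0 ≤ 1 - θ := by linarith [hθ.2]
  refine (mul_le_mul hA hB (by positivity) (by positivity)).trans ?_
  rw [mul_mul_mul_comm, ← Real.exp_add]
  refine mul_le_mul_of_nonneg_left (Real.exp_le_exp.2 ?_) (by positivity)
  have e1 : p = √p * √p := (Real.mul_self_sqrt hp0.le).symm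
  have e2 : 1 - p = √(1 - p) * √(1 - p) := (Real.mul_self_sqrt hq0.le).symm
  have e3 : θ = √θ * √θ := (Real.mul_self_sqrt hθ.1).symm
  have e4 : 1 - θ = √(1 - θ) * √(1 - θ) := (Real.mul_self_sqrt hθ').symm
  have f1 : 2 * (s : ℝ) * (√θ / √p - 1) = (s + t) * (2 * √p * √θ - 2 * p) := by
    have : 0 < √p := Real.sqrt_pos.2 hp0
    have e5 : p / √p = √p := Real.div_sqrt
    calc _ = 2 * ((s + t) * p) * (√θ / √p - 1) := by rw [← hsp]
      _ = (s + t) * (2 * (p / √p) * √θ - 2 * p) := by ring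
      _ = _ := by rw [e5]
  have f2 : 2 * (t : ℝ) * (√(1 - θ) / √(1 - p) - 1) =
      (s + t) * (2 * √(1 - p) * √(1 - θ) - 2 * (1 - p)) := by
    have e5 : (1 - p) / √(1 - p) = √(1 - p) := Real.div_sqrt
    calc _ = 2 * ((s + t) * (1 - p)) * (√(1 - θ) / √(1 - p) - 1) := by rw [← htp]
      _ = (s + t) * (2 * ((1 - p) / √(1 - p)) * √(1 - θ) - 2 * (1 - p)) := by ring
      _ = _ := by rw [e5]
  rw [f1, f2, ← mul_add]
  have bound : ∀ {u v : ℝ}, 0 ≤ u → u ≤ 1 → 0 ≤ v → v ≤ 1 →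
      (u - v) ^ 2 ≤ 4 * (√u - √v) ^ 2 := by
    intro u v hu0 hu1 hv0 hv1
    have hu2 : √u ≤ 1 := by simpa using Real.sqrt_le_sqrt hu1
    have hv2 : √v ≤ 1 := by simpa using Real.sqrt_le_sqrt hv1
    have h5 : u - v = (√u + √v) * (√u - √v) := by
      nlinarith [Real.mul_self_sqrt hu0, Real.mul_self_sqrt hv0]
    rw [h5, mul_pow]
    refine mul_le_mul_of_nonneg_right ?_ (sq_nonneg _)
    nlinarith [Real.sqrt_nonneg u, Real.sqrt_nonneg v]
  have b1 := bound hp0.le (by linarith) hθ.1 hθ.2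
  have b2 := bound hq0.le (by linarith) hθ' (by linarith [hθ.1])
  -- The left side is -(√p - √θ)² - (√(1 - p) - √(1 - θ))², and each square is at least (θ - p)²/4.
  have : 2 * √p * √θ - 2 * p + (2 * √(1 - p) * √(1 - θ) - 2 * (1 - p)) ≤
      -((θ - p) ^ 2 / 2) := by nlinarith
  calc _ ≤ (s + t) * (-((θ - p) ^ 2 / 2)) := mul_le_mul_of_nonneg_left this hn.le
    _ = _ := by ring

/-- Relative entropy is at most the χ² divergence, which for two Bernoulli laws is (θ - p)²/(θ(1 -
θ)). -/
lemma mul_exp_le_pow_mul_pow {s t : ℕ} (hn : 0 < s + t) {θ : ℝ}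
    (hθ : θ ∈ Set.Ioo (0 : ℝ) 1) :
    ((s / (s + t) : ℝ) ^ s * (1 - s / (s + t) : ℝ) ^ t) *
        Real.exp (-((s + t) * (θ - s / (s + t)) ^ 2 / (θ * (1 - θ)))) ≤
      θ ^ s * (1 - θ) ^ t := by
  have hn : (0 : ℝ) < s + t := by exact_mod_cast hn
  set p : ℝ := s / (s + t) with hp
  have hp0 : 0 ≤ p := by positivity
  have hq : 1 - p = t / (s + t) := by rw [hp]; field_simp; ring
  have hq0 : 0 ≤ 1 - p := by rw [hq]; positivity
  have hsp : (s : ℝ) = (s + t) * p := by rw [hp]; field_simp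
  have htp : (t : ℝ) = (s + t) * (1 - p) := by rw [hq]; field_simp
  have key : ∀ (u v : ℝ) (j : ℕ), 0 ≤ u → 0 < v →
      u ^ j ≤ v ^ j * Real.exp (j * (u / v - 1)) := by
    intro u v j hu hv
    have h2 : (u / v) ^ j ≤ Real.exp (j * (u / v - 1)) := by
      rw [Real.exp_nat_mul]
      refine pow_le_pow_left₀ (by positivity) ?_ _
      linarith [Real.add_one_le_exp (u / v - 1)]
    rw [div_pow, div_le_iff₀ (by positivity)] at h2
    linarith
  obtain ⟨hθ0, hθ1⟩ := hθ
  have hθ' : 0 < 1 - θ := by linarith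
  have h := mul_le_mul (key p θ s hp0 hθ0) (key (1 - p) (1 - θ) t hq0 hθ')
    (by positivity) (by positivity)
  rw [mul_mul_mul_comm, ← Real.exp_add] at h
  rw [Real.exp_neg, ← div_eq_mul_inv, div_le_iff₀ (Real.exp_pos _)]
  convert h using 3
  calc _ = (s + t) * (p * (p / θ - 1) + (1 - p) * ((1 - p) / (1 - θ) - 1)) := by
        rw [mul_div_assoc]
        congr 1
        field_simp
        ring
    _ = ((s + t) * p) * (p / θ - 1) + ((s + t) * (1 - p)) * ((1 - p) / (1 - θ) - 1) := by ring
    _ = _ := by rw [← hsp, ← htp]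

/-! ### The prior near θ₀ -/

/-- On `Metric.ball θ₀ δ` the measure `π` lies between `a` and `b` times Lebesgue measure. -/
def ComparableToVolumeOnBall (π : Measure I) (θ₀ : I) (δ a b : ℝ) : Prop :=
  ∀ A : Set I, MeasurableSet A → A ⊆ Metric.ball θ₀ δ →
    ENNReal.ofReal a * volume A ≤ π A ∧ π A ≤ ENNReal.ofReal b * volume A

lemma HasContinuousPositiveDensityNear.exists_comparableToVolumeOnBall {π : Measure I} {θ₀ : I}
    (h : HasContinuousPositiveDensityNear π θ₀) {ε : ℝ} (hε : 0 < ε) :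
    ∃ δ a b : ℝ, 0 < δ ∧ δ ≤ ε ∧ 0 < a ∧ 0 < b ∧ ComparableToVolumeOnBall π θ₀ δ a b := by
  obtain ⟨U, hU, hmem, f, hf, hpos, hπ⟩ := h
  have hf0 := hpos θ₀ hmem
  have hev : ∀ᶠ θ in 𝓝 θ₀, θ ∈ U ∧ f θ₀ / 2 < f θ ∧ f θ < 2 * f θ₀ := by
    have hcont := hf.continuousAt (hU.mem_nhds hmem)
    filter_upwards [hU.mem_nhds hmem, hcont.eventually (lt_mem_nhds (half_lt_self hf0)),
      hcont.eventually (gt_mem_nhds (show f θ₀ < 2 * f θ₀ by linarith))] with θ h1 h2 h3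
    exact ⟨h1, h2, h3⟩
  obtain ⟨δ, hδ, hball⟩ := Metric.eventually_nhds_iff_ball.1 hev
  refine ⟨min δ ε, f θ₀ / 2, 2 * f θ₀, lt_min hδ hε, min_le_right _ _, by positivity,
    by positivity, fun A hA hsub => ?_⟩
  have hA' : ∀ θ ∈ A, θ ∈ U ∧ f θ₀ / 2 < f θ ∧ f θ < 2 * f θ₀ := fun θ hθ =>
    hball θ (Metric.ball_subset_ball (min_le_left _ _) (hsub hθ))
  rw [hπ A hA fun θ hθ => (hA' θ hθ).1, ← setLIntegral_const, ← setLIntegral_const]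
  exact ⟨setLIntegral_mono' hA fun θ hθ => ENNReal.ofReal_le_ofReal (hA' θ hθ).2.1.le,
    setLIntegral_mono' hA fun θ hθ => ENNReal.ofReal_le_ofReal (hA' θ hθ).2.2.le⟩

lemma integral_unitInterval_le_integral {g : ℝ → ℝ} (hg : Integrable g) (h0 : ∀ x, 0 ≤ g x) :
    ∫ θ : I, g θ ≤ ∫ x, g x := by
  have : ∫ θ : I, g θ = ∫ x in I, g x := integral_subtype_comap measurableSet_Icc g
  rw [this]
  exact setIntegral_le_integral hg (ae_of_all _ h0)

/-- On the ball the prior is dominated by `b` times Lebesgue measure, giving a Gaussian integral;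
off it |θ - p| ≥ δ/2, and the total mass 1 suffices. -/
lemma ComparableToVolumeOnBall.integral_exp_le {π : Measure I} [IsProbabilityMeasure π]
    {θ₀ : I} {δ a b : ℝ} (h : ComparableToVolumeOnBall π θ₀ δ a b) (hδ : 0 < δ) (hb : 0 < b)
    {p : ℝ} (hp : |p - θ₀| < δ / 2) {N : ℝ} (hN : 0 < N) :
    ∫ θ : I, Real.exp (-(N / 4) * ((θ : ℝ) - p) ^ 2) ∂π ≤
      (b * √(4 * Real.pi) + 4 / δ) / √N := by
  set g : ℝ → ℝ := fun x => Real.exp (-(N / 4) * (x - p) ^ 2) with hg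
  have hgi : Integrable (fun θ : I => g θ) π :=
    integrable_of_continuous_unitInterval (by fun_prop)
  have hgR : Integrable g := (integrable_exp_neg_mul_sq (b := N / 4) (by positivity)).comp_sub_right p
  have hV : MeasurableSet (Metric.ball θ₀ δ) := Metric.isOpen_ball.measurableSet
  rw [← integral_add_compl hV hgi, add_div]
  refine add_le_add ?_ ?_
  · have hle : π.restrict (Metric.ball θ₀ δ) ≤ ENNReal.ofReal b • (volume : Measure I) := by
      refine Measure.le_iff.2 fun A hA => ?_
      rw [Measure.restrict_apply hA]
      refine (h _ (hA.inter hV) Set.inter_subset_right).2.trans ?_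
      rw [Measure.smul_apply, smul_eq_mul]
      gcongr
      exact Set.inter_subset_left
    have hi : Integrable (fun θ : I => g θ) (ENNReal.ofReal b • (volume : Measure I)) :=
      (integrable_of_continuous_unitInterval (by fun_prop)).smul_measure ENNReal.ofReal_ne_top
    calc _ ≤ ∫ θ : I, g θ ∂(ENNReal.ofReal b • (volume : Measure I)) :=
          integral_mono_measure hle (ae_of_all _ fun θ => (Real.exp_pos _).le) hi
      _ = b * ∫ θ : I, g θ := by
          rw [integral_smul_measure, ENNReal.toReal_ofReal hb.le, smul_eq_mul]
      _ ≤ b * ∫ x, g x := by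
          gcongr
          exact integral_unitInterval_le_integral hgR fun x => (Real.exp_pos _).le
      _ = _ := by
          rw [hg, integral_sub_right_eq_self (fun x => Real.exp (-(N / 4) * x ^ 2)) p,
            integral_gaussian, mul_div_assoc, ← Real.sqrt_div (by positivity)]
          congr 2
          field_simp
  · have hfar : ∀ θ ∈ (Metric.ball θ₀ δ)ᶜ, g θ ≤ 4 / δ / √N := by
      intro θ hθ
      have h1 : δ ≤ |(θ : ℝ) - θ₀| := by
        simpa [Subtype.dist_eq, Real.dist_eq] using hθ
      have h2 : δ / 2 ≤ |(θ : ℝ) - p| := by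
        have := abs_sub_le (θ : ℝ) p θ₀
        linarith
      have h3 : (δ / 2) ^ 2 ≤ ((θ : ℝ) - p) ^ 2 := by
        rw [← sq_abs ((θ : ℝ) - p)]
        exact pow_le_pow_left₀ (by positivity) h2 2
      have hs : 0 < √N := Real.sqrt_pos.2 hN
      have hsq : √N ^ 2 = N := Real.sq_sqrt hN.le
      have h4 : N / 4 * (δ / 2) ^ 2 = (δ * √N / 4) ^ 2 := by
        rw [div_pow (δ * √N), mul_pow, hsq]
        ring
      -- With y = δ√N/4, exp(y²) ≥ 1 + y² ≥ y: a crude bound, but already of the required order.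
      have h5 : δ * √N / 4 ≤ Real.exp (N / 4 * ((θ : ℝ) - p) ^ 2) := by
        have h6 : N / 4 * (δ / 2) ^ 2 ≤ N / 4 * ((θ : ℝ) - p) ^ 2 := by gcongr
        nlinarith [Real.add_one_le_exp (N / 4 * ((θ : ℝ) - p) ^ 2),
          sq_nonneg (δ * √N / 4 - 1)]
      simp only [hg, neg_mul, Real.exp_neg]
      calc _ ≤ (δ * √N / 4)⁻¹ := inv_anti₀ (by positivity) h5
        _ = _ := by field_simp
    calc _ ≤ ∫ θ in (Metric.ball θ₀ δ)ᶜ, 4 / δ / √N ∂π :=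
          setIntegral_mono_on hgi.integrableOn (integrable_const _) hV.compl hfar
      _ ≤ _ := by
          rw [setIntegral_const, smul_eq_mul]
          exact mul_le_of_le_one_left (by positivity) measureReal_le_one

/-- The bounds on δ keep the interval about p inside [0,1], so none of its length 2r is cut off. -/
lemma ComparableToVolumeOnBall.mul_le_measureReal_closedBall {π : Measure I}
    [IsProbabilityMeasure π] {θ₀ : I} {δ a b : ℝ} (h : ComparableToVolumeOnBall π θ₀ δ a b)
    (ha : 0 < a) (hδ0 : δ ≤ θ₀) (hδ1 : δ ≤ 1 - θ₀) {p r : ℝ} (hp : |p - θ₀| < δ / 2)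
    (hrδ : r ≤ δ / 2) :
    a * (2 * r) ≤ π.real {θ : I | |(θ : ℝ) - p| ≤ r} := by
  have hmeas : MeasurableSet {θ : I | |(θ : ℝ) - p| ≤ r} :=
    measurableSet_le (by fun_prop) measurable_const
  have hsub : {θ : I | |(θ : ℝ) - p| ≤ r} ⊆ Metric.ball θ₀ δ := by
    intro θ hθ
    have hθ' : |(θ : ℝ) - p| ≤ r := hθ
    rw [Metric.mem_ball, Subtype.dist_eq, Real.dist_eq]
    linarith [abs_sub_le (θ : ℝ) p θ₀]
  have hvol : volume {θ : I | |(θ : ℝ) - p| ≤ r} = ENNReal.ofReal (2 * r) := by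
    rw [← volume_image_subtype_coe measurableSet_Icc, ← Real.volume_closedBall p r]
    congr 1
    ext x
    simp only [Set.mem_image, Set.mem_ofPred_eq, Metric.mem_closedBall, Real.dist_eq]
    refine ⟨fun ⟨θ, hθ, hx⟩ => hx ▸ hθ, fun hx => ⟨⟨x, ?_, ?_⟩, hx, rfl⟩⟩
    · linarith [(abs_le.1 hx).1, (abs_lt.1 hp).1]
    · linarith [(abs_le.1 hx).2, (abs_lt.1 hp).2]
  have := (h _ hmeas hsub).1
  rw [hvol, ← ENNReal.ofReal_mul ha.le] at this
  exact (ENNReal.ofReal_le_iff_le_toReal (measure_ne_top _ _)).1 this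

/-! ### The posterior and its second moment -/

lemma successCount_le (x : ℕ → Bool) (n : ℕ) : successCount x n ≤ n := by
  simpa [successCount] using Finset.card_filter_le (Finset.range n) fun i => x i = true

lemma bernoulliLikelihood_nonneg (x : ℕ → Bool) (n : ℕ) (θ : I) :
    0 ≤ bernoulliLikelihood x n θ :=
  mul_nonneg (pow_nonneg θ.2.1 _) (pow_nonneg (by linarith [θ.2.2]) _)

lemma continuous_bernoulliLikelihood (x : ℕ → Bool) (n : ℕ) :
    Continuous (bernoulliLikelihood x n) := by
  unfold bernoulliLikelihood
  fun_prop

lemma integral_bernoulliPosterior {π : Measure I} [IsFiniteMeasure π] (x : ℕ → Bool) (n : ℕ)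
    (g : I → ℝ) :
    ∫ θ, g θ ∂(bernoulliPosterior π x n) =
      (∫ θ, bernoulliLikelihood x n θ ∂π)⁻¹ * ∫ θ, bernoulliLikelihood x n θ * g θ ∂π := by
  rw [bernoulliPosterior, integral_smul_measure,
    integral_withDensity_eq_integral_toReal_smul
      (continuous_bernoulliLikelihood x n).measurable.ennreal_ofReal
      (ae_of_all _ fun _ => ENNReal.ofReal_lt_top),
    ← ofReal_integral_eq_lintegral_ofReal
      (integrable_of_continuous_unitInterval (continuous_bernoulliLikelihood x n))
      (ae_of_all _ (bernoulliLikelihood_nonneg x n)),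
    ENNReal.toReal_inv, ENNReal.toReal_ofReal (integral_nonneg (bernoulliLikelihood_nonneg x n))]
  simp [ENNReal.toReal_ofReal (bernoulliLikelihood_nonneg x n _)]

lemma isProbabilityMeasure_bernoulliPosterior {π : Measure I} [IsFiniteMeasure π]
    {x : ℕ → Bool} {n : ℕ} (h : 0 < ∫ θ, bernoulliLikelihood x n θ ∂π) :
    IsProbabilityMeasure (bernoulliPosterior π x n) := by
  constructor
  have hZ := ofReal_integral_eq_lintegral_ofReal (μ := π)
    (integrable_of_continuous_unitInterval (continuous_bernoulliLikelihood x n))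
    (ae_of_all _ (bernoulliLikelihood_nonneg x n))
  rw [bernoulliPosterior, Measure.smul_apply, withDensity_apply _ MeasurableSet.univ,
    Measure.restrict_univ, smul_eq_mul, ← hZ]
  exact ENNReal.inv_mul_cancel (by simpa using h) ENNReal.ofReal_ne_top

/-- The posterior second moment about the empirical frequency is of order `1 / n`, uniformly over
data whose empirical frequency is close to `θ₀`. -/
lemma ComparableToVolumeOnBall.integral_sq_sub_bernoulliPosterior_le {π : Measure I}
    [IsProbabilityMeasure π] {θ₀ : I} {δ a b : ℝ} (h : ComparableToVolumeOnBall π θ₀ δ a b)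
    (hδ : 0 < δ) (ha : 0 < a) (hb : 0 < b) (hδ0 : δ ≤ θ₀ / 2) (hδ1 : δ ≤ (1 - θ₀) / 2) :
    ∃ C : ℝ, ∀ (x : ℕ → Bool) (n : ℕ), 0 < n →
      |(successCount x n : ℝ) / n - θ₀| < δ / 2 →
      0 < ∫ θ, bernoulliLikelihood x n θ ∂π ∧
        ∫ θ, ((θ : ℝ) - successCount x n / n) ^ 2 ∂(bernoulliPosterior π x n) ≤ C / n := by
  -- On the window of radius r = δ/(2√n), n(θ - p)² ≤ δ²/4 and θ(1 - θ) ≥ (θ₀/2)((1 - θ₀)/2), while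
  -- the prior mass is at least a·2r = aδ/√n.
  set c : ℝ := Real.exp (-(δ ^ 2 / 4 / (θ₀ / 2 * ((1 - θ₀) / 2)))) * (a * δ) with hc
  set B : ℝ := b * √(4 * Real.pi) + 4 / δ with hB
  have hc0 : 0 < c := by positivity
  refine ⟨4 * B / c, fun x n hn hp => ?_⟩
  set s := successCount x n with hs
  set t := n - s with ht
  have hst : s + t = n := Nat.add_sub_cancel' (successCount_le x n)
  have hstR : (s : ℝ) + t = n := by exact_mod_cast hst
  have hnR : (0 : ℝ) < n := by exact_mod_cast hn
  have hn1 : (1 : ℝ) ≤ n := by exact_mod_cast hn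
  set p : ℝ := s / n with hpdef
  obtain ⟨hpl, hpu⟩ := abs_lt.1 hp
  have hp0 : 0 < p := by linarith
  have hp1 : p < 1 := by linarith
  have hs0 : 0 < s := by
    have : (0 : ℝ) < s := by
      have := mul_pos hp0 hnR
      rwa [hpdef, div_mul_cancel₀ _ hnR.ne'] at this
    exact_mod_cast this
  have ht0 : 0 < t := by
    have : (s : ℝ) < n := (div_lt_one hnR).1 hp1
    have : s < n := by exact_mod_cast this
    omega
  set M : ℝ := p ^ s * (1 - p) ^ t with hM
  have hM0 : 0 < M := mul_pos (pow_pos hp0 _) (pow_pos (by linarith) _)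
  have hup : ∀ θ : I, bernoulliLikelihood x n θ ≤
      M * Real.exp (-(n * ((θ : ℝ) - p) ^ 2 / 2)) := by
    intro θ
    have := pow_mul_pow_le_mul_exp hs0 ht0 (θ := θ) θ.2
    rwa [hstR] at this
  have hsn : 0 < √(n : ℝ) := Real.sqrt_pos.2 hnR
  have hsq : √(n : ℝ) ^ 2 = n := Real.sq_sqrt hnR.le
  set r : ℝ := δ / (2 * √(n : ℝ)) with hr
  have hr0 : 0 ≤ r := by positivity
  have hrδ : r ≤ δ / 2 := by
    have : (1 : ℝ) ≤ √n := by simpa using Real.sqrt_le_sqrt hn1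
    rw [hr]
    exact div_le_div_of_nonneg_left hδ.le (by norm_num) (by linarith)
  have hLi : Integrable (bernoulliLikelihood x n) π :=
    integrable_of_continuous_unitInterval (continuous_bernoulliLikelihood x n)
  have hden : M * (c / √n) ≤ ∫ θ, bernoulliLikelihood x n θ ∂π := by
    set A : Set I := {θ : I | |(θ : ℝ) - p| ≤ r} with hA
    have hAm : MeasurableSet A := measurableSet_le (by fun_prop) measurable_const
    have hlow : ∀ θ ∈ A, M * Real.exp (-(δ ^ 2 / 4 / (θ₀ / 2 * ((1 - θ₀) / 2)))) ≤
        bernoulliLikelihood x n θ := by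
      intro θ hθ
      have hθ' : |(θ : ℝ) - p| ≤ r := hθ
      obtain ⟨h1, h2⟩ := abs_le.1 hθ'
      have hθl : (θ₀ : ℝ) / 2 ≤ θ := by linarith
      have hθu : (1 - (θ₀ : ℝ)) / 2 ≤ 1 - θ := by linarith
      have := mul_exp_le_pow_mul_pow (s := s) (t := t) (by omega) (θ := θ)
        ⟨by linarith, by linarith⟩
      rw [hstR] at this
      refine le_trans (mul_le_mul_of_nonneg_left (Real.exp_le_exp.2 (neg_le_neg ?_)) hM0.le) this
      have h3 : n * ((θ : ℝ) - p) ^ 2 ≤ δ ^ 2 / 4 := by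
        have h4 : ((θ : ℝ) - p) ^ 2 ≤ r ^ 2 := by
          rw [← sq_abs]
          exact pow_le_pow_left₀ (abs_nonneg _) hθ' 2
        calc (n : ℝ) * ((θ : ℝ) - p) ^ 2 ≤ n * r ^ 2 := by gcongr
          _ = _ := by
            rw [hr, div_pow, mul_pow, hsq]
            field_simp
            norm_num
      have h5 : (0 : ℝ) < θ₀ / 2 := by linarith
      have h6 : (0 : ℝ) < (1 - θ₀) / 2 := by linarith
      have h7 : (0 : ℝ) ≤ θ := θ.2.1
      gcongr
    have hAπ := h.mul_le_measureReal_closedBall ha (by linarith) (by linarith) hp hrδ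
    calc M * (c / √n)
        = (a * (2 * r)) * (M * Real.exp (-(δ ^ 2 / 4 / (θ₀ / 2 * ((1 - θ₀) / 2))))) := by
          rw [hc, hr]
          field_simp
      _ ≤ π.real A * (M * Real.exp (-(δ ^ 2 / 4 / (θ₀ / 2 * ((1 - θ₀) / 2))))) := by gcongr
      _ = ∫ θ in A, M * Real.exp (-(δ ^ 2 / 4 / (θ₀ / 2 * ((1 - θ₀) / 2)))) ∂π := by
          rw [setIntegral_const, smul_eq_mul]
      _ ≤ ∫ θ in A, bernoulliLikelihood x n θ ∂π :=
          setIntegral_mono_on (integrable_const _) hLi.integrableOn hAm hlow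
      _ ≤ _ := setIntegral_le_integral hLi (ae_of_all _ (bernoulliLikelihood_nonneg x n))
  have hZ : 0 < ∫ θ, bernoulliLikelihood x n θ ∂π := lt_of_lt_of_le (by positivity) hden
  refine ⟨hZ, ?_⟩
  have hnum : ∫ θ, bernoulliLikelihood x n θ * ((θ : ℝ) - p) ^ 2 ∂π ≤
      M * (4 / n) * (B / √n) := by
    have hpt : ∀ θ : I, bernoulliLikelihood x n θ * ((θ : ℝ) - p) ^ 2 ≤
        M * (4 / n) * Real.exp (-(n / 4) * ((θ : ℝ) - p) ^ 2) := by
      intro θ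
      set u : ℝ := ((θ : ℝ) - p) ^ 2 with hu
      -- Half of the Gaussian exponent absorbs the factor u at the price of 4/n; the other half is
      -- left to integrate.
      have hE : n / 4 * u * Real.exp (-(n / 4) * u) ≤ 1 := by
        rw [neg_mul, Real.exp_neg, ← div_eq_mul_inv, div_le_one (Real.exp_pos _)]
        linarith [Real.add_one_le_exp (n / 4 * u)]
      have hsplit : Real.exp (-(n * u / 2)) =
          Real.exp (-(n / 4) * u) * Real.exp (-(n / 4) * u) := by
        rw [← Real.exp_add]
        ring_nf
      calc _ ≤ M * Real.exp (-(n * u / 2)) * u :=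
            mul_le_mul_of_nonneg_right (hup θ) (sq_nonneg _)
        _ = M * (4 / n) * Real.exp (-(n / 4) * u) * (n / 4 * u * Real.exp (-(n / 4) * u)) := by
            rw [hsplit]
            field_simp
        _ ≤ _ := mul_le_of_le_one_right (by positivity) hE
    calc _ ≤ ∫ θ : I, M * (4 / n) * Real.exp (-(n / 4) * ((θ : ℝ) - p) ^ 2) ∂π :=
          integral_mono (integrable_of_continuous_unitInterval
            ((continuous_bernoulliLikelihood x n).mul (by fun_prop)))
            (integrable_of_continuous_unitInterval (by fun_prop)) hpt
      _ ≤ _ := by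
          rw [integral_const_mul]
          exact mul_le_mul_of_nonneg_left (h.integral_exp_le hδ hb hp hnR) (by positivity)
  rw [integral_bernoulliPosterior, inv_mul_eq_div, div_le_iff₀ hZ]
  calc _ ≤ _ := hnum
    _ = 4 * B / c / n * (M * (c / √n)) := by field_simp
    _ ≤ _ := mul_le_mul_of_nonneg_left hden (by positivity)

/-! ### The pathwise rate and the strong law -/

lemma isBigO_bayesPredictive_sub_plugInPredictive {π : Measure I} [IsProbabilityMeasure π]
    {θ₀ : I} (hθ₀_pos : 0 < (θ₀ : ℝ)) (hθ₀_lt : (θ₀ : ℝ) < 1)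
    (hπ : HasContinuousPositiveDensityNear π θ₀) (k : ℕ) {x : ℕ → Bool}
    (hx : Tendsto (fun n : ℕ => (successCount x n : ℝ) / n) atTop (𝓝 θ₀)) :
    (fun n : ℕ => bayesPredictive π k x n - plugInPredictive π k x n)
      =O[atTop] (fun n : ℕ => (1 : ℝ) / (n : ℝ)) := by
  obtain ⟨δ, a, b, hδ, hδle, ha, hb, h⟩ := hπ.exists_comparableToVolumeOnBall
    (ε := min ((θ₀ : ℝ) / 2) ((1 - θ₀) / 2)) (lt_min (by linarith) (by linarith))
  obtain ⟨C, hC⟩ := h.integral_sq_sub_bernoulliPosterior_le hδ ha hb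
    (hδle.trans (min_le_left _ _)) (hδle.trans (min_le_right _ _))
  refine IsBigO.of_bound (k ^ 2 * C) ?_
  filter_upwards [eventually_gt_atTop 0, hx.eventually (Metric.ball_mem_nhds _ (half_pos hδ))]
    with n hn hp
  rw [Real.dist_eq] at hp
  obtain ⟨hZ, hbd⟩ := hC x n hn hp
  have := isProbabilityMeasure_bernoulliPosterior hZ
  have hmain := abs_integral_pow_sub_pow_integral_le (bernoulliPosterior π x n) k
    (successCount x n / n)
  rw [Real.norm_eq_abs, Real.norm_of_nonneg (by positivity)]
  calc _ ≤ _ := hmain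
    _ ≤ k ^ 2 * (C / n) := by gcongr
    _ = _ := by ring

lemma ae_tendsto_successCount_div {Ω : Type*} [MeasurableSpace Ω] {P : Measure Ω}
    [IsProbabilityMeasure P] {θ₀ : I} {X : ℕ → Ω → Bool} (hX_indep : iIndepFun X P)
    (hX_law : ∀ i, HasLaw (X i) (bernoulliMeasure true false θ₀) P) :
    ∀ᵐ ω ∂P, Tendsto (fun n : ℕ => (successCount (fun i => X i ω) n : ℝ) / n) atTop
      (𝓝 (θ₀ : ℝ)) := by
  set φ : Bool → ℝ := fun c => if c = true then 1 else 0 with hφ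
  have hφm : Measurable φ := measurable_of_finite φ
  have hid : ∀ i, IdentDistrib (fun ω => φ (X i ω)) (fun ω => φ (X 0 ω)) P P := fun i =>
    IdentDistrib.comp ⟨(hX_law i).aemeasurable, (hX_law 0).aemeasurable,
      (hX_law i).map_eq.trans (hX_law 0).map_eq.symm⟩ hφm
  have hint : Integrable (fun ω => φ (X 0 ω)) P := by
    refine Integrable.of_bound (hφm.comp_aemeasurable (hX_law 0).aemeasurable).aestronglyMeasurable
      1 (ae_of_all _ fun ω => ?_)
    by_cases hc : X 0 ω = true <;> simp [hφ, hc]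
  have hmean : ∫ ω, φ (X 0 ω) ∂P = θ₀ := by
    rw [← integral_map (hX_law 0).aemeasurable hφm.aestronglyMeasurable, (hX_law 0).map_eq,
      integral_bernoulliMeasure]
    simp [hφ]
  have h := strong_law_ae_real (fun i ω => φ (X i ω)) hint
    (fun i j hij => (hX_indep.indepFun hij).comp hφm hφm) hid
  rw [hmean] at h
  filter_upwards [h] with ω hω
  simpa [hφ, successCount] using hω

theorem mainTheorem9 {Ω : Type*} [MeasurableSpace Ω] (P : Measure Ω) [IsProbabilityMeasure P]
    (θ₀ : I) (hθ₀_pos : 0 < (θ₀ : ℝ)) (hθ₀_lt : (θ₀ : ℝ) < 1)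
    (X : ℕ → Ω → Bool) (hX_indep : iIndepFun X P)
    (hX_law : ∀ i, HasLaw (X i) (bernoulliMeasure true false θ₀) P)
    (π : Measure I) [IsProbabilityMeasure π] (hπ : HasContinuousPositiveDensityNear π θ₀)
    (k : ℕ) (hk : 2 ≤ k) :
    ∀ᵐ ω ∂P,
      (fun n : ℕ => bayesPredictive π k (fun i => X i ω) n
          - plugInPredictive π k (fun i => X i ω) n)
        =O[atTop] (fun n : ℕ => (1 : ℝ) / (n : ℝ)) := by
  filter_upwards [ae_tendsto_successCount_div hX_indep hX_law] with ω hω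
  exact isBigO_bayesPredictive_sub_plugInPredictive hθ₀_pos hθ₀_lt hπ k hω
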